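/- Let $U$ be a finite set. A simple oriented matroid on $U$ is a nonempty set $\mathcal{L}\subseteq\{+,-,0\}^U$ (its elements are called covectors) such that (C) $X\circ Y\in\mathcal{L}$ for all $X,Y\in\mathcal{L}$, where $(X\circ Y)_e=X_e$ if $X_e\ne 0$ and $(X\circ Y)_e=Y_e$ otherwise; (SE) for all $X,Y\in\mathcal{L}$ and every $e\in\mathrm{Sep}(X,Y)=\{f\in U:\{X_f,Y_f\}=\{+,-\}\}$ there is $Z\in\mathcal{L}$ with $Z_e=0$ and $Z_f=(X\circ Y)_f$ for all $f\in U\setminus\mathrm{Sep}(X,Y)$; (Sym) $-X\in\mathcal{L}$ for all $X\in\mathcal{L}$; (Simple) $\{X_e: X\in\mathcal{L}\}=\{+,-,0\}$ for every $e\in U$, and for all $e\neq f$ in $U$ there are $X,Y\in\mathcal{L}$ with $X_e=X_f$, $Y_e\ne Y_f$ and $X_e,X_f,Y_e,Y_f\in\{+,-\}$. Order $\mathcal{L}$ by $X\le Y$ if and only if $X_e\in\{0,Y_e\}$ for every $e\in U$. Let the topes be the elements of $\mathcal{L}\cap\{+,-\}^U$, each identified with the subset $\{e\in U: X_e=+\}$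 of $U$, and let $d$ be the VC-dimension of the set of topes, that is, the largest cardinality of a set $S\subseteq U$ such that every subset of $S$ is of the form $S\cap T$ for some tope $T$. Then all maximal chains of $(\mathcal{L},\le)$ have the same number of elements, and the rank of the oriented matroid, defined as this number minus one, equals $d$. -/

import Mathlib

/-- A sign vector on the ground set `U`; the signs `+`, `-`, `0` are the elements `1`, `-1`, `0`
of `SignType`. -/
abbrev SignVector (U : Type*) := U → SignType

namespace SignVector

variable {U : Type*}

/-- The separator of `X` and `Y`: the elements at which they have opposite nonzero signs. -/
def sep (X Y : SignVector U) : Set U :=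
  {e | (X e = 1 ∧ Y e = -1) ∨ (X e = -1 ∧ Y e = 1)}

/-- The composition `X ∘ Y`: equal to `X` where `X` is nonzero and to `Y` elsewhere. -/
def comp (X Y : SignVector U) : SignVector U :=
  fun e => if X e = 0 then Y e else X e

/-- The product order on sign vectors derived from `0 ≤ +` and `0 ≤ -` (with `+` and `-`
incomparable). This is not the order `-1 < 0 < 1` that Mathlib puts on `SignType`. -/
def Conforms (X Y : SignVector U) : Prop :=
  ∀ e, X e = 0 ∨ X e = Y e

/-- The subset of `U` on which a sign vector is `+`; it identifies `{+, -}^U` with the family of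
all subsets of `U`. -/
def posSet [Fintype U] (X : SignVector U) : Finset U :=
  {e | X e = 1}

end SignVector

/-- An oriented matroid on `U`, given by its covectors. -/
structure OrientedMatroid (U : Type*) where
  covectors : Set (SignVector U)
  comp_mem : ∀ X ∈ covectors, ∀ Y ∈ covectors, SignVector.comp X Y ∈ covectors
  strong_elimination : ∀ X ∈ covectors, ∀ Y ∈ covectors, ∀ e ∈ SignVector.sep X Y,
    ∃ Z ∈ covectors, Z e = 0 ∧ ∀ f, f ∉ SignVector.sep X Y → Z f = SignVector.comp X Y f
  neg_mem : ∀ X ∈ covectors, -X ∈ covectors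

namespace OrientedMatroid

variable {U : Type*}

/-- Every element takes all three signs, and any two distinct elements are neither parallel nor
antiparallel. -/
structure IsSimple (M : OrientedMatroid U) : Prop where
  signs : ∀ e, {s | ∃ X ∈ M.covectors, X e = s} = Set.univ
  separated : ∀ e f, e ≠ f → ∃ X ∈ M.covectors, ∃ Y ∈ M.covectors,
    X e = X f ∧ Y e ≠ Y f ∧ X e ≠ 0 ∧ X f ≠ 0 ∧ Y e ≠ 0 ∧ Y f ≠ 0

/-- `C` is a maximal chain of the covector poset. -/
def IsMaximalChain (M : OrientedMatroid U) (C : Set M.covectors) : Prop :=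
  IsMaxChain (fun X Y : M.covectors => SignVector.Conforms X.1 Y.1) C

/-- The rank: the length (number of elements) of the maximal chains of the covector poset, minus
one; formally the supremum over all maximal chains. -/
noncomputable def rank (M : OrientedMatroid U) : ℕ :=
  sSup {r | ∃ C : Set M.covectors, M.IsMaximalChain C ∧ C.ncard = r + 1}

/-- The topes: the covectors without zero entries. -/
def topes (M : OrientedMatroid U) : Set (SignVector U) :=
  {X ∈ M.covectors | ∀ e, X e ≠ 0}

/-- The set of topes, viewed as a family of subsets of `U`. -/
noncomputable def topeFamily [Fintype U] [DecidableEq U] (M : OrientedMatroid U) :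
    Finset (Finset U) :=
  M.topes.toFinite.toFinset.image SignVector.posSet

end OrientedMatroid

/-! Call `S` shattered if every nonzero sign pattern on `S` extends to a covector. Grade a covector
`X` by the largest size of a set shattered by the covectors vanishing on the zeros of `X`. This
grade is 0 at the zero vector and `shatterDim` at topes. It strictly increases along the order
(`grade_lt`), and by at most one along covers (`grade_le_of_cover`, from `Shatters.exchange` and
`exists_between`), so every maximal chain has `shatterDim + 1` elements. Composing with a tope shows
that covectors and topes shatter the same sets. -/

namespace OrientedMatroid

open SignVector

/-! ### Maximal chains in graded posets. -/

/-- If a finite poset carries a strictly monotone function that increases by at most one along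
covering pairs, vanishes at the bottom and takes the value `d` above every element, then its
maximal chains have `d + 1` elements. -/
theorem ncard_maxChain_of_grade {α : Type*} [Finite α] {r : α → α → Prop}
    (hrefl : ∀ a, r a a) (htrans : ∀ a b c, r a b → r b c → r a c)
    (ρ : α → ℕ) (d : ℕ) (bot : α) (hbot : ∀ a, r bot a) (hρbot : ρ bot = 0)
    (htop : ∀ a, ∃ b, r a b ∧ ρ b = d)
    (hstrict : ∀ a b, r a b → a ≠ b → ρ a < ρ b)
    (hcov : ∀ a b, r a b → a ≠ b → (∀ c, r a c → r c b → c = a ∨ c = b) → ρ b ≤ ρ a + 1)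
    {C : Set α} (hC : IsMaxChain r C) : C.ncard = d + 1 := by
  have hmem : ∀ a, (∀ b ∈ C, r a b ∨ r b a) → a ∈ C := by
    intro a ha
    have h := hC.2 (hC.1.insert fun b hb _ => ha b hb) (Set.subset_insert a C)
    rw [h]
    exact Set.mem_insert a C
  have hle : ∀ a ∈ C, ∀ b ∈ C, ρ a ≤ ρ b → r a b := by
    intro a ha b hb hab
    by_cases h : a = b
    · rw [h]; exact hrefl b
    rcases hC.1 ha hb h with h1 | h1
    · exact h1
    · exact absurd (hstrict b a h1 (Ne.symm h)) (by omega)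
  have hd : ∀ a, ρ a ≤ d := by
    intro a
    obtain ⟨b, hab, hb⟩ := htop a
    by_cases h : a = b
    · rw [h, hb]
    · exact hb ▸ (hstrict a b hab h).le
  have hbotC : bot ∈ C := hmem bot fun b _ => Or.inl (hbot b)
  have htopC : ∃ a ∈ C, ρ a = d := by
    obtain ⟨a, haC, ha⟩ := Set.exists_max_image C ρ C.toFinite ⟨bot, hbotC⟩
    obtain ⟨b, hab, hb⟩ := htop a
    exact ⟨b, hmem b fun c hc => Or.inr (htrans _ _ _ (hle c hc a haC (ha c hc)) hab), hb⟩
  have hsurj : ∀ k ≤ d, ∃ a ∈ C, ρ a = k := by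
    intro k
    induction k with
    | zero => exact fun _ => ⟨bot, hbotC, hρbot⟩
    | succ k ih =>
      intro hk
      obtain ⟨a, haC, ha⟩ := ih (by omega)
      obtain ⟨t, htC, ht⟩ := htopC
      -- The next chain element `b` after `a` covers `a`: anything strictly between is comparable
      -- with all of `C`, hence lies in `C`.
      obtain ⟨b, ⟨hbC, hb⟩, hmin⟩ := Set.exists_min_image {b ∈ C | k < ρ b} ρ
        (Set.toFinite _) ⟨t, htC, by omega⟩
      have hne : a ≠ b := by rintro rfl; omega
      have hab : r a b := hle a haC b hbC (by omega)
      refine ⟨b, hbC, ?_⟩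
      have := hcov a b hab hne fun c hac hcb => by
        by_contra! hc
        have h1 := hstrict a c hac hc.1.symm
        have h2 := hstrict c b hcb hc.2
        have hcC : c ∈ C := hmem c fun x hx => by
          by_cases hxk : k < ρ x
          · exact Or.inl (htrans _ _ _ hcb (hle b hbC x hx (hmin x ⟨hx, hxk⟩)))
          · exact Or.inr (htrans _ _ _ (hle x hx a haC (by omega)) hac)
        have := hmin c ⟨hcC, by omega⟩
        omega
      omega
  have hinj : Set.InjOn ρ C := by
    intro a ha b hb hab
    by_contra h
    exact absurd (hstrict a b (hle a ha b hb hab.le) h) (by omega)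
  have himg : ρ '' C = Set.Iic d := by
    ext k
    constructor
    · rintro ⟨a, -, rfl⟩
      exact hd a
    · exact fun hk => hsurj k hk
  rw [← hinj.ncard_image, himg, Set.ncard_eq_toFinset_card']
  simp

/-! ### Calculus of sign vectors. -/

variable {U : Type*}

theorem comp_of_ne {X : SignVector U} (Y : SignVector U) {e : U} (h : X e ≠ 0) :
    comp X Y e = X e := if_neg h

theorem comp_of_eq {X : SignVector U} (Y : SignVector U) {e : U} (h : X e = 0) :
    comp X Y e = Y e := if_pos h

theorem comp_ne_zero (X : SignVector U) {Y : SignVector U} {e : U} (h : Y e ≠ 0) :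
    comp X Y e ≠ 0 := by
  by_cases h1 : X e = 0
  · rwa [comp_of_eq Y h1]
  · rwa [comp_of_ne Y h1]

theorem conforms_comp (X Y : SignVector U) : Conforms X (comp X Y) := fun e => by
  by_cases h : X e = 0
  · exact Or.inl h
  · exact Or.inr (comp_of_ne Y h).symm

theorem conforms_trans {X Y Z : SignVector U} (h : Conforms X Y) (h' : Conforms Y Z) :
    Conforms X Z := fun e => by
  rcases h e with h1 | h1
  · exact Or.inl h1
  · exact h1 ▸ h' e

theorem eq_zero_of_conforms {X Y : SignVector U} (h : Conforms X Y) {e : U} (he : Y e = 0) :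
    X e = 0 := (h e).elim id fun h1 => h1.trans he

theorem exists_of_conforms_of_ne {X Y : SignVector U} (h : Conforms X Y) (hne : X ≠ Y) :
    ∃ e, X e = 0 ∧ Y e ≠ 0 := by
  obtain ⟨e, he⟩ := Function.ne_iff.1 hne
  have h0 := (h e).resolve_right he
  exact ⟨e, h0, fun h1 => he (h0.trans h1.symm)⟩

theorem mem_sep_of_eq_neg {X Y : SignVector U} {e : U} (hX : X e ≠ 0) (h : Y e = -X e) :
    e ∈ sep X Y := by
  show _ ∨ _
  rw [h]
  revert hX
  generalize X e = s
  revert s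
  decide

theorem notMem_sep_of_left {X Y : SignVector U} {e : U} (h : X e = 0) : e ∉ sep X Y := by
  rintro (⟨h1, -⟩ | ⟨h1, -⟩) <;> simp [h] at h1

theorem notMem_sep_of_right {X Y : SignVector U} {e : U} (h : Y e = 0) : e ∉ sep X Y := by
  rintro (⟨-, h1⟩ | ⟨-, h1⟩) <;> simp [h] at h1

theorem notMem_sep_of_eq {X Y : SignVector U} {e : U} (h : X e = Y e) : e ∉ sep X Y := by
  rintro (⟨h1, h2⟩ | ⟨h1, h2⟩) <;> rw [h, h2] at h1 <;> exact absurd h1 (by decide)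

theorem eq_of_notMem_sep {X Y : SignVector U} {e : U} (h : e ∉ sep X Y) (hX : X e ≠ 0)
    (hY : Y e ≠ 0) : X e = Y e := by
  have h' : ¬ ((X e = 1 ∧ Y e = -1) ∨ (X e = -1 ∧ Y e = 1)) := h
  revert h' hX hY
  generalize X e = s
  generalize Y e = t
  revert s t
  decide

/-! ### Contraction and shattering. -/

variable (M : OrientedMatroid U)

/-- The covectors of `M` vanishing on `A`. -/
def contract (A : Set U) : OrientedMatroid U where
  covectors := {X ∈ M.covectors | ∀ a ∈ A, X a = 0}
  comp_mem := fun X hX Y hY =>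
    ⟨M.comp_mem X hX.1 Y hY.1, fun a ha => (comp_of_eq Y (hX.2 a ha)).trans (hY.2 a ha)⟩
  strong_elimination := fun X hX Y hY e he => by
    obtain ⟨Z, hZ, hZe, hZf⟩ := M.strong_elimination X hX.1 Y hY.1 e he
    refine ⟨Z, ⟨hZ, fun a ha => ?_⟩, hZe, hZf⟩
    rw [hZf a (notMem_sep_of_left (hX.2 a ha)), comp_of_eq Y (hX.2 a ha), hY.2 a ha]
  neg_mem := fun X hX => ⟨M.neg_mem X hX.1, fun a ha => by simp [hX.2 a ha]⟩

/-- Every pattern of nonzero signs on `S` extends to a covector. -/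
def Shatters (S : Finset U) : Prop :=
  ∀ σ : SignVector U, (∀ e ∈ S, σ e ≠ 0) → ∃ Z ∈ M.covectors, ∀ e ∈ S, Z e = σ e

variable {M}

/-- Zeros in a pattern come from strong elimination: replace one zero by `1` and by `-1`, then
eliminate between the two covectors, which agree on the rest of `S`. -/
theorem Shatters.exists_eq {S : Finset U} (h : M.Shatters S) (σ : SignVector U) :
    ∃ Z ∈ M.covectors, ∀ e ∈ S, Z e = σ e := by
  classical
  induction hn : (S.filter fun e => σ e = 0).card using Nat.strong_induction_on
    generalizing σ with
  | _ n ih =>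
    by_cases h0 : ∀ e ∈ S, σ e ≠ 0
    · exact h σ h0
    push Not at h0
    obtain ⟨e, heS, he⟩ := h0
    have hlt : ∀ s : SignType, s ≠ 0 →
        (S.filter fun x => Function.update σ e s x = 0).card < n := by
      intro s hs
      rw [← hn]
      refine Finset.card_lt_card (Finset.ssubset_iff_of_subset ?_ |>.2 ⟨e, ?_, ?_⟩)
      · intro x hx
        rw [Finset.mem_filter] at hx ⊢
        by_cases hxe : x = e
        · exact ⟨hx.1, hxe ▸ he⟩
        · exact ⟨hx.1, by simpa [Function.update_of_ne hxe] using hx.2⟩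
      · simp [heS, he]
      · simp [hs]
    obtain ⟨X, hX, hXS⟩ := ih _ (hlt 1 (by decide)) _ rfl
    obtain ⟨Y, hY, hYS⟩ := ih _ (hlt (-1) (by decide)) _ rfl
    obtain ⟨Z, hZ, hZe, hZf⟩ := M.strong_elimination X hX Y hY e
      (Or.inl ⟨by simpa using hXS e heS, by simpa using hYS e heS⟩)
    refine ⟨Z, hZ, fun f hf => ?_⟩
    by_cases hfe : f = e
    · rw [hfe, hZe, he]
    have hXf := hXS f hf
    have hYf := hYS f hf
    rw [Function.update_of_ne hfe] at hXf hYf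
    rw [hZf f (notMem_sep_of_eq (hXf.trans hYf.symm))]
    by_cases h1 : X f = 0
    · rw [comp_of_eq Y h1, hYf]
    · rw [comp_of_ne Y h1, hXf]

/-- While `X` has at least two nonzero entries on `S`, pick one, `f`, and a covector `V` whose only
nonzero entry on `S` is `-X f`. Either `V e ≠ 0` and `V` serves, or eliminating `f` keeps `X e` and
shrinks the support on `S`. -/
theorem Shatters.exists_card_le_one {S : Finset U} (h : M.Shatters S) {X : SignVector U}
    (hX : X ∈ M.covectors) {e : U} (he : X e ≠ 0) :
    ∃ V ∈ M.covectors, V e ≠ 0 ∧ (S.filter fun g => V g ≠ 0).card ≤ 1 := by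
  classical
  induction hn : (S.filter fun g => X g ≠ 0).card using Nat.strong_induction_on
    generalizing X with
  | _ n ih =>
    by_cases h1 : (S.filter fun g => X g ≠ 0).card ≤ 1
    · exact ⟨X, hX, he, h1⟩
    obtain ⟨f, hf⟩ := Finset.card_pos.1 (show 0 < (S.filter fun g => X g ≠ 0).card by omega)
    rw [Finset.mem_filter] at hf
    obtain ⟨V, hV, hVS⟩ := h.exists_eq (Function.update 0 f (-X f))
    have hVf : V f = -X f := by simpa using hVS f hf.1
    have hVg : ∀ g ∈ S, g ≠ f → V g = 0 := fun g hg hgf => by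
      simpa [Function.update_of_ne hgf] using hVS g hg
    by_cases hVe : V e = 0
    · obtain ⟨Z, hZ, hZf, hZg⟩ := M.strong_elimination X hX V hV f
        (mem_sep_of_eq_neg hf.2 hVf)
      have hZe : Z e = X e := by rw [hZg e (notMem_sep_of_right hVe), comp_of_ne V he]
      refine ih _ ?_ hZ (hZe ▸ he) rfl
      rw [← hn]
      refine Finset.card_lt_card (Finset.ssubset_iff_of_subset ?_ |>.2 ⟨f, ?_, ?_⟩)
      · intro g hg
        rw [Finset.mem_filter] at hg ⊢
        refine ⟨hg.1, fun hXg => hg.2 ?_⟩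
        by_cases hgf : g = f
        · rw [hgf, hZf]
        · have := hVg g hg.1 hgf
          rw [hZg g (notMem_sep_of_right this), comp_of_eq V hXg, this]
      · exact Finset.mem_filter.2 hf
      · simp [hZf]
    · refine ⟨V, hV, hVe, Finset.card_le_one.2 fun a ha b hb => ?_⟩
      rw [Finset.mem_filter] at ha hb
      have ha' : a = f := by_contra fun hc => ha.2 (hVg a ha.1 hc)
      have hb' : b = f := by_contra fun hc => hb.2 (hVg b hb.1 hc)
      rw [ha', hb']

/-- As in basis exchange, `e` replaces the at most one element of `S` where `V` is nonzero: `V` or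
`-V` sets the sign at `e`, and composition fills in the rest. -/
theorem Shatters.exchange {S : Finset U} (h : M.Shatters S) {X : SignVector U}
    (hX : X ∈ M.covectors) {e : U} (he : X e ≠ 0) :
    ∃ S', e ∈ S' ∧ S.card ≤ S'.card ∧ M.Shatters S' := by
  classical
  obtain ⟨V, hV, hVe, hcard⟩ := h.exists_card_le_one hX he
  refine ⟨insert e (S.filter fun g => ¬ V g ≠ 0), Finset.mem_insert_self _ _, ?_, ?_⟩
  · rw [Finset.card_insert_of_notMem (by simp [hVe])]
    have := Finset.card_filter_add_card_filter_not (s := S) (fun g => V g ≠ 0)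
    omega
  · intro σ hσ
    obtain ⟨Y, hY, hYS⟩ := h.exists_eq σ
    obtain ⟨W, hW, hWe, hW0⟩ : ∃ W ∈ M.covectors, W e = σ e ∧ ∀ g, V g = 0 → W g = 0 := by
      by_cases hs : V e = σ e
      · exact ⟨V, hV, hs, fun _ h => h⟩
      · refine ⟨-V, M.neg_mem V hV, ?_, fun g hg => by simp [hg]⟩
        have hσe := hσ e (Finset.mem_insert_self _ _)
        rw [Pi.neg_apply]
        revert hs hσe hVe
        generalize V e = s
        generalize σ e = t
        revert s t
        decide
    refine ⟨comp W Y, M.comp_mem W hW Y hY, fun g hg => ?_⟩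
    rcases Finset.mem_insert.1 hg with rfl | hg'
    · rw [comp_of_ne Y (hWe ▸ hσ g hg), hWe]
    · simp only [ne_eq, not_not, Finset.mem_filter] at hg'
      rw [comp_of_eq Y (hW0 g hg'.2), hYS g hg'.1]

/-! ### Conformal elimination. -/

variable [Fintype U]

open Classical in
/-- Conformal elimination: moving from `Y` towards `X`, one reaches a first separating element. -/
theorem exists_conforms_of_sep {X Y : SignVector U} (hX : X ∈ M.covectors)
    (hY : Y ∈ M.covectors) (h0 : ∀ e, Y e = 0 → X e = 0) {g : U} (hg : g ∈ sep Y X) :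
    ∃ V ∈ M.covectors, Conforms V Y ∧ (∃ f ∈ sep Y X, V f = 0) ∧
      ∀ f, f ∉ sep Y X → V f = Y f := by
  induction hn : (Finset.univ.filter fun e => e ∈ sep Y X).card using Nat.strong_induction_on
    generalizing X g with
  | _ n ih =>
    obtain ⟨Z, hZ, hZg, hZf⟩ := M.strong_elimination Y hY X hX g hg
    have hZY : ∀ f, f ∉ sep Y X → Z f = Y f := by
      intro f hf
      rw [hZf f hf]
      by_cases h1 : Y f = 0
      · rw [comp_of_eq X h1, h0 f h1, h1]
      · exact comp_of_ne X h1
    have hZ0 : ∀ e, Y e = 0 → Z e = 0 := fun e he =>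
      (hZY e (notMem_sep_of_left he)).trans he
    have hsub : sep Y Z ⊆ sep Y X := fun f hf => by
      by_contra hc
      exact notMem_sep_of_eq (hZY f hc).symm hf
    by_cases hs : ∃ f, f ∈ sep Y Z
    · obtain ⟨f, hf⟩ := hs
      obtain ⟨V, hV, hVY, ⟨f', hf', hVf'⟩, hVf⟩ := ih _ (by
        rw [← hn]
        refine Finset.card_lt_card (Finset.ssubset_iff_of_subset ?_ |>.2 ⟨g, ?_, ?_⟩)
        · exact fun x hx => by simpa using hsub (by simpa using hx)
        · simpa using hg
        · simpa using notMem_sep_of_right hZg) hZ hZ0 hf rfl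
      exact ⟨V, hV, hVY, ⟨f', hsub hf', hVf'⟩, fun x hx => hVf x fun hc => hx (hsub hc)⟩
    · push Not at hs
      refine ⟨Z, hZ, fun e => ?_, ⟨g, hg, hZg⟩, hZY⟩
      by_cases h1 : Z e = 0
      · exact Or.inl h1
      · exact Or.inr (eq_of_notMem_sep (hs e) (fun h => h1 (hZ0 e h)) h1).symm

/-- `comp X Z` lies above `X`. If nothing separates it from `Y`, it is the required covector;
otherwise conformal elimination from `Y` yields one, which keeps `Y e ≠ 0` and acquires a zero in
the support of `Y`. -/
theorem exists_between {X Y Z : SignVector U} (hX : X ∈ M.covectors) (hY : Y ∈ M.covectors)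
    (hZ : Z ∈ M.covectors) (hXY : Conforms X Y) {e f : U} (hXe : X e = 0) (hYe : Y e ≠ 0)
    (hZ0 : ∀ g, Y g = 0 → Z g = 0) (hZe : Z e = 0) (hXf : X f = 0) (hZf : Z f ≠ 0) :
    ∃ V ∈ M.covectors, Conforms X V ∧ Conforms V Y ∧ V ≠ X ∧ V ≠ Y := by
  have hW := M.comp_mem X hX Z hZ
  have hWe : comp X Z e = 0 := (comp_of_eq Z hXe).trans hZe
  have hW0 : ∀ g, Y g = 0 → comp X Z g = 0 := fun g hg =>
    (comp_of_eq Z (eq_zero_of_conforms hXY hg)).trans (hZ0 g hg)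
  by_cases hs : ∃ g, g ∈ sep Y (comp X Z)
  · obtain ⟨g, hg⟩ := hs
    obtain ⟨V, hV, hVY, ⟨k, hk, hVk⟩, hVf⟩ := exists_conforms_of_sep hW hY hW0 hg
    refine ⟨V, hV, fun h => ?_, hVY, fun h => ?_, fun h => ?_⟩
    · by_cases h1 : X h = 0
      · exact Or.inl h1
      · have h2 := (hXY h).resolve_left h1
        right
        rw [hVf h (notMem_sep_of_eq (h2.symm.trans (comp_of_ne Z h1).symm)), h2]
    · have := hVf e (notMem_sep_of_right hWe)
      rw [h, hXe] at this
      exact hYe this.symm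
    · exact notMem_sep_of_left (h ▸ hVk) hk
  · push Not at hs
    refine ⟨_, hW, conforms_comp X Z, fun g => ?_, fun h => ?_, fun h => ?_⟩
    · by_cases h1 : comp X Z g = 0
      · exact Or.inl h1
      · exact Or.inr (eq_of_notMem_sep (hs g) (fun h => h1 (hW0 g h)) h1).symm
    · exact hZf (by rw [← comp_of_eq Z hXf, h, hXf])
    · exact hYe (by rw [← h, hWe])

/-! ### The grade of a covector. -/

variable (M)

open Classical in
/-- The largest cardinality of a set all of whose sign patterns are restrictions of covectors. -/
noncomputable def shatterDim : ℕ := (Finset.univ.filter M.Shatters).sup Finset.card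

variable {M}

theorem Shatters.card_le {S : Finset U} (h : M.Shatters S) : S.card ≤ M.shatterDim :=
  Finset.le_sup (f := Finset.card) (by simpa using h)

theorem exists_shatters (hne : M.covectors.Nonempty) :
    ∃ S, M.Shatters S ∧ S.card = M.shatterDim := by
  classical
  obtain ⟨X, hX⟩ := hne
  obtain ⟨S, hS, h⟩ := Finset.exists_mem_eq_sup (Finset.univ.filter M.Shatters)
    ⟨∅, by simpa using show M.Shatters ∅ from fun σ _ => ⟨X, hX, by simp⟩⟩ Finset.card
  exact ⟨S, by simpa using hS, h.symm⟩

variable (M) in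
/-- The shattering dimension of the contraction of the zero set of `X`. -/
noncomputable def grade (X : SignVector U) : ℕ := (M.contract {e | X e = 0}).shatterDim

/-- A set shattered below `X` can be enlarged by any `e` with `X e = 0 ≠ Y e`, the sign at `e` being
supplied by `Y` or `-Y`. -/
theorem grade_lt {X Y : SignVector U} (hX : X ∈ M.covectors) (hY : Y ∈ M.covectors)
    (hXY : Conforms X Y) (hne : X ≠ Y) : M.grade X < M.grade Y := by
  classical
  obtain ⟨e, hXe, hYe⟩ := exists_of_conforms_of_ne hXY hne
  obtain ⟨S, hS, hcard⟩ := exists_shatters (M := M.contract {e | X e = 0})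
    ⟨X, hX, fun _ h => h⟩
  have heS : e ∉ S := by
    intro he
    obtain ⟨Z, hZ, hZS⟩ := hS (fun _ => 1) fun _ _ => by decide
    exact absurd ((hZ.2 e hXe).symm.trans (hZS e he)) (by decide)
  have : (M.contract {e | Y e = 0}).Shatters (insert e S) := by
    intro σ hσ
    obtain ⟨Z, hZ, hZS⟩ := hS σ fun f hf => hσ f (Finset.mem_insert_of_mem hf)
    obtain ⟨W, hW, hWe, hW0⟩ : ∃ W ∈ M.covectors, W e = σ e ∧ ∀ g, Y g = 0 → W g = 0 := by
      by_cases hs : Y e = σ e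
      · exact ⟨Y, hY, hs, fun _ h => h⟩
      · refine ⟨-Y, M.neg_mem Y hY, ?_, fun g hg => by simp [hg]⟩
        have hσe := hσ e (Finset.mem_insert_self _ _)
        rw [Pi.neg_apply]
        revert hs hσe hYe
        generalize Y e = s
        generalize σ e = t
        revert s t
        decide
    refine ⟨comp Z W, ⟨M.comp_mem Z hZ.1 W hW, fun a ha => ?_⟩, fun g hg => ?_⟩
    · rw [comp_of_eq W (hZ.2 a (eq_zero_of_conforms hXY ha)), hW0 a ha]
    · rcases Finset.mem_insert.1 hg with rfl | hg'
      · rw [comp_of_eq W (hZ.2 g hXe), hWe]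
      · have := hZS g hg'
        rw [comp_of_ne W (this ▸ hσ g hg), this]
  have hle := this.card_le
  rw [Finset.card_insert_of_notMem heS, hcard] at hle
  exact hle

theorem grade_le_of_cover {X Y : SignVector U} (hX : X ∈ M.covectors) (hY : Y ∈ M.covectors)
    (hXY : Conforms X Y) (hne : X ≠ Y)
    (hcov : ∀ V ∈ M.covectors, Conforms X V → Conforms V Y → V = X ∨ V = Y) :
    M.grade Y ≤ M.grade X + 1 := by
  classical
  obtain ⟨e, hXe, hYe⟩ := exists_of_conforms_of_ne hXY hne
  have hYc : Y ∈ (M.contract {e | Y e = 0}).covectors := ⟨hY, fun _ h => h⟩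
  obtain ⟨S, hS, hcard⟩ := exists_shatters ⟨Y, hYc⟩
  obtain ⟨S', heS', hle, hS'⟩ := hS.exchange hYc hYe
  have : (M.contract {e | X e = 0}).Shatters (S'.erase e) := by
    intro σ _
    obtain ⟨Z, hZ, hZS⟩ := hS'.exists_eq (Function.update σ e 0)
    have hZe : Z e = 0 := by simpa using hZS e heS'
    refine ⟨Z, ⟨hZ.1, fun f hf => ?_⟩, fun g hg => ?_⟩
    -- If `Z` were nonzero at a zero of `X`, a covector would lie strictly between `X` and `Y`.
    · by_contra hZf
      obtain ⟨V, hV, h1, h2, h3, h4⟩ :=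
        exists_between hX hY hZ.1 hXY hXe hYe hZ.2 hZe hf hZf
      exact (hcov V hV h1 h2).elim h3 h4
    · rw [Finset.mem_erase] at hg
      simpa [Function.update_of_ne hg.1] using hZS g hg.2
  have h1 := this.card_le
  rw [Finset.card_erase_of_mem heS'] at h1
  change (M.contract {e | Y e = 0}).shatterDim ≤ (M.contract {e | X e = 0}).shatterDim + 1
  omega

/-! ### The zero covector and topes. -/

theorem zero_mem (hne : M.covectors.Nonempty) : (0 : SignVector U) ∈ M.covectors := by
  classical
  obtain ⟨X, hX⟩ := hne
  induction hn : (Finset.univ.filter fun e => X e ≠ 0).card using Nat.strong_induction_on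
    generalizing X with
  | _ n ih =>
    by_cases h0 : X = 0
    · exact h0 ▸ hX
    obtain ⟨e, he⟩ := Function.ne_iff.1 h0
    have he' : X e ≠ 0 := he
    -- Eliminating between `X` and `-X` shrinks the support.
    obtain ⟨Z, hZ, hZe, hZf⟩ := M.strong_elimination X hX (-X) (M.neg_mem X hX) e
      (mem_sep_of_eq_neg he' rfl)
    refine ih _ ?_ Z hZ rfl
    rw [← hn]
    refine Finset.card_lt_card (Finset.ssubset_iff_of_subset ?_ |>.2 ⟨e, ?_, ?_⟩)
    · intro g hg
      rw [Finset.mem_filter] at hg ⊢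
      refine ⟨hg.1, fun h => hg.2 ?_⟩
      rw [hZf g (notMem_sep_of_left h), comp_of_eq _ h, Pi.neg_apply, h, neg_zero]
    · simpa using he'
    · simp [hZe]

theorem topes_nonempty (hne : M.covectors.Nonempty)
    (hloop : ∀ e, ∃ X ∈ M.covectors, X e ≠ 0) : M.topes.Nonempty := by
  classical
  obtain ⟨X, hX⟩ := hne
  induction hn : (Finset.univ.filter fun e => X e = 0).card using Nat.strong_induction_on
    generalizing X with
  | _ n ih =>
    by_cases h0 : ∀ e, X e ≠ 0
    · exact ⟨X, hX, h0⟩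
    push Not at h0
    obtain ⟨e, he⟩ := h0
    obtain ⟨Y, hY, hYe⟩ := hloop e
    refine ih _ ?_ (comp X Y) (M.comp_mem X hX Y hY) rfl
    rw [← hn]
    refine Finset.card_lt_card (Finset.ssubset_iff_of_subset ?_ |>.2 ⟨e, ?_, ?_⟩)
    · intro g hg
      rw [Finset.mem_filter] at hg ⊢
      exact ⟨hg.1, eq_zero_of_conforms (conforms_comp X Y) hg.2⟩
    · simpa using he
    · simpa [comp_of_eq Y he] using hYe

theorem grade_zero : M.grade 0 = 0 := by
  classical
  unfold grade shatterDim
  rw [← Nat.le_zero]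
  refine Finset.sup_le fun S hS => ?_
  have hS : (M.contract {e | (0 : SignVector U) e = 0}).Shatters S := by simpa using hS
  rw [Nat.le_zero, Finset.card_eq_zero, Finset.eq_empty_iff_forall_notMem]
  intro e he
  obtain ⟨Z, hZ, hZS⟩ := hS (fun _ => 1) fun _ _ => by decide
  exact absurd ((hZ.2 e rfl).symm.trans (hZS e he)) (by decide)

theorem grade_tope {X : SignVector U} (hX : ∀ e, X e ≠ 0) : M.grade X = M.shatterDim := by
  have : M.contract {e | X e = 0} = M := by
    obtain ⟨L, _, _, _⟩ := M
    simp [contract, hX]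
  rw [grade, this]

/-! ### VC-dimension and rank. -/

theorem shatters_topeFamily_iff [DecidableEq U] (hT : M.topes.Nonempty) (S : Finset U) :
    M.topeFamily.Shatters S ↔ M.Shatters S := by
  obtain ⟨T, hT, hT0⟩ := hT
  have hmem : ∀ u, u ∈ M.topeFamily ↔ ∃ X ∈ M.topes, posSet X = u := by
    intro u
    simp [topeFamily]
  constructor
  · intro h σ hσ
    obtain ⟨u, hu, hSu⟩ := h (Finset.filter_subset (fun e => σ e = 1) S)
    obtain ⟨X, ⟨hX, hX0⟩, rfl⟩ := (hmem u).1 hu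
    refine ⟨X, hX, fun e he => ?_⟩
    have h1 := Finset.ext_iff.1 hSu e
    simp only [posSet, Finset.mem_inter, Finset.mem_filter, Finset.mem_univ, true_and, he] at h1
    have h2 := hX0 e
    have h3 := hσ e he
    revert h1 h2 h3
    generalize X e = s
    generalize σ e = t
    revert s t
    decide
  · intro h t ht
    obtain ⟨Z, hZ, hZS⟩ := h (fun e => if e ∈ t then 1 else -1) fun e _ => by
      by_cases he : e ∈ t <;> simp [he]
    -- Composing with `T` fills the zeros of `Z` without changing it on `S`.
    refine ⟨posSet (comp Z T), (hmem _).2 ⟨_, ⟨M.comp_mem Z hZ T hT, fun e =>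
      comp_ne_zero Z (hT0 e)⟩, rfl⟩, ?_⟩
    · ext e
      simp only [posSet, Finset.mem_inter, Finset.mem_filter, Finset.mem_univ, true_and]
      by_cases he : e ∈ S
      · have h1 := hZS e he
        have h2 : Z e ≠ 0 := by
          rw [h1]
          by_cases het : e ∈ t <;> simp [het]
        rw [comp_of_ne T h2, h1]
        by_cases het : e ∈ t <;> simp [he, het]
      · exact ⟨fun h => absurd h.1 he, fun h => absurd (ht h) he⟩

theorem vcDim_topeFamily [DecidableEq U] (hT : M.topes.Nonempty) :
    M.topeFamily.vcDim = M.shatterDim := by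
  classical
  unfold Finset.vcDim shatterDim
  congr 1
  ext S
  simp [shatters_topeFamily_iff hT]

theorem ncard_maximalChain (hne : M.covectors.Nonempty) (hT : M.topes.Nonempty)
    {C : Set M.covectors} (hC : M.IsMaximalChain C) : C.ncard = M.shatterDim + 1 := by
  refine ncard_maxChain_of_grade
    (r := fun X Y : M.covectors => Conforms X.1 Y.1) (fun _ _ => Or.inr rfl) (fun _ _ _ => conforms_trans)
    (fun X => M.grade X.1) _ ⟨0, zero_mem hne⟩ (fun _ _ => Or.inl rfl) grade_zero ?_ ?_ ?_ hC
  · rintro ⟨X, hX⟩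
    obtain ⟨T, hT, hT0⟩ := hT
    refine ⟨⟨comp X T, M.comp_mem X hX T hT⟩, conforms_comp X T,
      grade_tope fun e => comp_ne_zero X (hT0 e)⟩
  · exact fun X Y h hXY => grade_lt X.2 Y.2 h fun hc => hXY (Subtype.ext hc)
  · intro X Y h hXY hcov
    refine grade_le_of_cover X.2 Y.2 h (fun hc => hXY (Subtype.ext hc)) fun V hV h1 h2 => ?_
    exact (hcov ⟨V, hV⟩ h1 h2).imp (congrArg Subtype.val) (congrArg Subtype.val)

theorem rank_eq_shatterDim (hne : M.covectors.Nonempty) (hT : M.topes.Nonempty) :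
    M.rank = M.shatterDim := by
  have : {r | ∃ C : Set M.covectors, M.IsMaximalChain C ∧ C.ncard = r + 1} =
      {M.shatterDim} := by
    ext r
    constructor
    · rintro ⟨C, hC, h⟩
      rw [ncard_maximalChain hne hT hC] at h
      exact (Nat.succ.inj h).symm
    -- A maximal chain must exist, since `sSup ∅ = 0` in `ℕ`.
    · rintro rfl
      exact ⟨_, maxChain_spec, ncard_maximalChain hne hT maxChain_spec⟩
  rw [rank, this, csSup_singleton]

end OrientedMatroid

theorem mainTheorem7 {U : Type*} [Fintype U] [DecidableEq U] (M : OrientedMatroid U)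
    (hne : M.covectors.Nonempty) (hM : M.IsSimple) :
    (∀ C : Set M.covectors, M.IsMaximalChain C → C.ncard = M.rank + 1) ∧
      M.rank = M.topeFamily.vcDim := by
  have hT : M.topes.Nonempty := OrientedMatroid.topes_nonempty hne fun e => by
    obtain ⟨X, hX, h⟩ := (hM.signs e).symm ▸ Set.mem_univ (1 : SignType)
    exact ⟨X, hX, by rw [h]; decide⟩
  rw [OrientedMatroid.vcDim_topeFamily hT, OrientedMatroid.rank_eq_shatterDim hne hT]
  exact ⟨fun C hC => OrientedMatroid.ncard_maximalChain hne hT hC, rfl⟩
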